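/- Fix $n\ge 2$ and write $[v,w]$ for the determinant with columns $v,w\in\mathbb{R}^2$. Let $P=P_1P_2\dots P_{2n}$ be a non-degenerate (strictly) convex polygon in the plane, with vertices in counter-clockwise order (indices in $\mathbb{Z}$, taken mod $2n$), symmetric about the origin: $P_{i+n}=-P_i$. Let $Q$ be its dual, i.e. the unique polygon with $[P_i,Q_i]=1$ and $[P_{i+1}-P_i,Q_i]=0$ for all $i$. A $P$-polygon is a polygonal line $M=(M_i)_{i\in\mathbb{Z}}$ with $M_{i+1}-M_i=r_i\,(P_{i+1}-P_i)$ for some real numbers $r_i$, its radii ($r_i=0$ is allowed); it is closed if $M_{i+2n}=M_i$ for all $i$, and convex if it lies on one side of the line through each of its non-degenerate sides. It has constant $P$-width if $w_i=[M_i,Q_i]+[M_{i+n},Q_{i+n}]$ does not depend on $i$. It is homothetic to $P$ if there are $X\in\mathbb{R}^2$ and $c\in\mathbb{R}$ (possibly $c=0$) with $M_i=X+cP_i$ for all $i$. An edgex of $M$ is a maximal block of consecutive sides with equal radii whose common radius is a strict extremum, i.e. strictly larger than the radii of both neighbouring sides or strictly smaller than both; equivalently, it is a zero-crossing of the sequence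 of differences $r_{i+1}-r_i$. The edgices of a closed $M$ are counted once per period of $2n$ sides. Theorem (four edgex theorem). Let $M$ be a closed convex $P$-polygon which is not homothetic to $P$. Then $M$ has at least four edgices. If moreover $M$ has constant $P$-width, then it has at least six edgices. -/

import Mathlib

/-- The plane `ℝ²`. -/
abbrev Plane : Type := ℝ × ℝ

/-- The determinant `[v, w]` of the matrix with columns `v` and `w`. -/
def det2 (v w : Plane) : ℝ := v.1 * w.2 - v.2 * w.1

/-- The forward difference `Δᵢ L = L (i + 1) - L i`. -/
def fwdDiffZ {V : Type*} [AddCommGroup V] (L : ℤ → V) (i : ℤ) : V := L (i + 1) - L i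

/-- A polygonal ball with `2n` vertices: a non-degenerate (strictly) convex polygon
`P₁ P₂ … P₂ₙ`, listed counter-clockwise with indices in `ℤ` taken mod `2n`, and symmetric about
the origin. Convexity with this orientation says that, for each directed side `Pᵢ Pᵢ₊₁`, every
vertex other than its two endpoints lies strictly to the left of it. -/
structure PolygonalBall (n : ℕ) where
  vertex : ℤ → Plane
  two_le : 2 ≤ n
  symm : ∀ i : ℤ, vertex (i + n) = - vertex i
  convex : ∀ i j : ℤ, ¬ j ≡ i [ZMOD 2 * n] → ¬ j ≡ i + 1 [ZMOD 2 * n] →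
    0 < det2 (vertex (i + 1) - vertex i) (vertex j - vertex i)

namespace PolygonalBall

variable {n : ℕ}

/-- The vertices of the dual polygon, `Qᵢ = Δᵢ P / [Pᵢ, Pᵢ₊₁]`. By the lemmas below this is the
only polygon with `[Pᵢ, Qᵢ] = 1` and `[Δᵢ P, Qᵢ] = 0` for all `i`. -/
noncomputable def dual (P : PolygonalBall n) (i : ℤ) : Plane :=
  (1 / det2 (P.vertex i) (P.vertex (i + 1))) • fwdDiffZ P.vertex i

theorem det2_vertex_pos (P : PolygonalBall n) (i : ℤ) :
    0 < det2 (P.vertex i) (P.vertex (i + 1)) := by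
  have hn := P.two_le
  have h := P.convex i (i + n)
    (by
      intro h
      obtain ⟨k, hk⟩ := h.dvd
      have h1 : (n : ℤ) * (1 + 2 * k) = 0 := by linear_combination -hk
      rcases mul_eq_zero.1 h1 with h2 | h2 <;> omega)
    (by
      intro h
      obtain ⟨k, hk⟩ := h.dvd
      have h1 : (n : ℤ) * (1 + 2 * k) = 1 := by linear_combination -hk
      have h2 : (n : ℤ) ∣ 1 := ⟨_, h1.symm⟩
      have := Int.le_of_dvd one_pos h2
      omega)
  rw [P.symm i] at h
  simp only [det2, Prod.fst_sub, Prod.snd_sub, Prod.fst_neg, Prod.snd_neg] at h ⊢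
  linarith

theorem det2_vertex_dual (P : PolygonalBall n) (i : ℤ) :
    det2 (P.vertex i) (P.dual i) = 1 := by
  have h := (P.det2_vertex_pos i).ne'
  have e : det2 (P.vertex i) (P.dual i) = (1 / det2 (P.vertex i) (P.vertex (i + 1))) *
      det2 (P.vertex i) (P.vertex (i + 1)) := by
    simp only [dual, fwdDiffZ]
    generalize 1 / det2 (P.vertex i) (P.vertex (i + 1)) = c
    simp only [det2, Prod.smul_fst, Prod.smul_snd, Prod.fst_sub, Prod.snd_sub, smul_eq_mul]
    ring
  rw [e, one_div_mul_cancel h]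

theorem det2_side_dual (P : PolygonalBall n) (i : ℤ) :
    det2 (fwdDiffZ P.vertex i) (P.dual i) = 0 := by
  simp only [dual]
  generalize 1 / det2 (P.vertex i) (P.vertex (i + 1)) = c
  simp only [det2, Prod.smul_fst, Prod.smul_snd, smul_eq_mul]
  ring

theorem eq_dual (P : PolygonalBall n) (Q : ℤ → Plane) (h1 : ∀ i, det2 (P.vertex i) (Q i) = 1)
    (h0 : ∀ i, det2 (fwdDiffZ P.vertex i) (Q i) = 0) : Q = P.dual := by
  funext i
  have hd := (P.det2_vertex_pos i).ne'
  have a1 := h1 i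
  have a0 := h0 i
  have b1 := P.det2_vertex_dual i
  have b0 := P.det2_side_dual i
  simp only [det2, fwdDiffZ, Prod.fst_sub, Prod.snd_sub] at a1 a0 b1 b0 hd
  apply Prod.ext
  · apply mul_left_cancel₀ hd
    linear_combination ((P.vertex (i + 1)).1 - (P.vertex i).1) * (a1 - b1) -
      (P.vertex i).1 * (a0 - b0)
  · apply mul_left_cancel₀ hd
    linear_combination ((P.vertex (i + 1)).2 - (P.vertex i).2) * (a1 - b1) -
      (P.vertex i).2 * (a0 - b0)

end PolygonalBall

/-- A `P`-polygon: a polygonal line `M` in the plane whose sides are parallel to the corresponding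
sides of `P`, together with its curvature radii `r`, so that `Δᵢ M = rᵢ Δᵢ P`. -/
structure PPolygon {n : ℕ} (P : PolygonalBall n) where
  vertex : ℤ → Plane
  radius : ℤ → ℝ
  side_eq : ∀ i : ℤ, fwdDiffZ vertex i = radius i • fwdDiffZ P.vertex i

namespace PPolygon

variable {n : ℕ} {P : PolygonalBall n}

/-- `M` is closed: its vertices repeat after one turn (`2n` sides). In particular its sides are
`2n`-periodic. -/
def IsClosedPolygon (M : PPolygon P) : Prop :=
  ∀ i : ℤ, M.vertex (i + 2 * n) = M.vertex i

/-- `M` is convex: it lies on one side of the line through each of its sides. Either orientation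
of `M` is allowed, and there is no condition at degenerate sides. -/
def IsConvexPolygon (M : PPolygon P) : Prop :=
  ∀ i : ℤ,
    (∀ j : ℤ, 0 ≤ det2 (M.vertex (i + 1) - M.vertex i) (M.vertex j - M.vertex i)) ∨
    (∀ j : ℤ, det2 (M.vertex (i + 1) - M.vertex i) (M.vertex j - M.vertex i) ≤ 0)

/-- `M` is homothetic to the ball `P`: it is `X + c P` for some point `X` and real `c`. (The ratio
`0` is included: the zero radii vector belongs to the space of balls.) -/
def IsHomotheticToBall (M : PPolygon P) : Prop :=
  ∃ (X : Plane) (c : ℝ), ∀ i : ℤ, M.vertex i = X + c • P.vertex i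

/-- The support `hᵢ = [Mᵢ, Qᵢ]`: the signed distance from the origin to the side `Mᵢ Mᵢ₊₁`,
normalized to be `1` for the ball `P`. -/
noncomputable def support (M : PPolygon P) (i : ℤ) : ℝ := det2 (M.vertex i) (P.dual i)

/-- The `P`-width `wᵢ = hᵢ + hᵢ₊ₙ` between the sides `Mᵢ Mᵢ₊₁` and `Mᵢ₊ₙ Mᵢ₊ₙ₊₁`. -/
noncomputable def width (M : PPolygon P) (i : ℤ) : ℝ := M.support i + M.support (i + n)

/-- `M` has constant `P`-width. -/
def HasConstantWidth (M : PPolygon P) : Prop := ∃ c : ℝ, ∀ i : ℤ, M.width i = c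

/-- The adjacent sides with indices `a, a + 1, …, b` form an edgex: their radii are equal, and
the common value is a strict extremum, i.e. larger than the radii of both neighbouring sides
`a - 1` and `b + 1`, or smaller than both. -/
def IsEdgex (M : PPolygon P) (a b : ℤ) : Prop :=
  a ≤ b ∧ (∀ i : ℤ, a ≤ i → i ≤ b → M.radius i = M.radius a) ∧
    ((M.radius (a - 1) < M.radius a ∧ M.radius (b + 1) < M.radius b) ∨
      (M.radius a < M.radius (a - 1) ∧ M.radius b < M.radius (b + 1)))

/-- The edgices are exactly the zero-crossings of the sequence `Δ r`. -/
theorem isEdgex_iff (M : PPolygon P) (a b : ℤ) :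
    M.IsEdgex a b ↔ a ≤ b ∧ (∀ i : ℤ, a ≤ i → i < b → fwdDiffZ M.radius i = 0) ∧
      fwdDiffZ M.radius (a - 1) * fwdDiffZ M.radius b < 0 := by
  simp only [IsEdgex, fwdDiffZ, sub_add_cancel, mul_neg_iff, sub_pos, sub_neg]
  refine and_congr_right fun hab => and_congr ⟨fun h i hi hib => ?_, fun h i hi => ?_⟩ Iff.rfl
  · rw [h i hi hib.le, h (i + 1) (by omega) (by omega), sub_self]
  · induction i, hi using Int.leInduction with
    | base => exact fun _ => rfl
    | succ i hi ih =>
      intro hib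
      rw [← ih (by omega)]
      exact sub_eq_zero.1 (h i hi (by omega))

/-- The number of edgices of `M` in one period of `2n` sides. An edgex is determined by its first
side `a`, and edgices whose indices differ by a multiple of `2n` are the same edgex of a closed
polygon, so we count the possible first sides `a` in `{1, …, 2n}`. -/
noncomputable def edgexCount (M : PPolygon P) : ℕ :=
  {a : ℤ | 1 ≤ a ∧ a ≤ 2 * n ∧ ∃ b : ℤ, M.IsEdgex a b}.ncard

end PPolygon

/-! ### Sign sequences -/

/-! Let D be the sequence of radius differences. Summation by parts turns closedness into
orthogonality of D, over a period, to every affine function restricted to the vertices of P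
(`sum_radius_diff_mul`). Hence D must oscillate. With constant sign it contradicts orthogonality to
constants; with two sign changes it contradicts orthogonality to the affine function vanishing on a
suitable diagonal of P (`not_two_constant_blocks`). Periodicity makes the number of sign changes
even, so it is at least four. Constant width makes D antiperiodic under i ↦ i + n. Each half period
then has an odd number of sign changes, so the total is twice an odd number; being at least four, it
is at least six. Zeros of D inherit the sign of the next nonzero term, so each sign change marks the
start of a distinct edgex (`signChanges_le_edgexCount`). -/

/-- The number of sign changes of `t` along `s, s + 1, …, s + m`. -/
noncomputable def signChanges (t : ℤ → ℝ) (s : ℤ) (m : ℕ) : ℕ :=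
  ∑ k ∈ Finset.range m, if t (s + k) ≠ t (s + k + 1) then 1 else 0

theorem signChanges_eq_card (t : ℤ → ℝ) (s : ℤ) (m : ℕ) :
    signChanges t s m = ((Finset.range m).filter fun k : ℕ => t (s + k) ≠ t (s + k + 1)).card := by
  rw [signChanges, Finset.card_filter]

theorem signChanges_add (t : ℤ → ℝ) (s : ℤ) (m m' : ℕ) :
    signChanges t s (m + m') = signChanges t s m + signChanges t (s + m) m' := by
  simp only [signChanges, Finset.sum_range_add]
  congr 1
  refine Finset.sum_congr rfl fun k _ => ?_
  push_cast
  rw [add_assoc s (m : ℤ) k]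

/-- Each sign change contributes a factor -1, so the parity of the count can be read off the two end
signs. -/
theorem eq_mul_neg_one_pow_signChanges {t : ℤ → ℝ} (ht : ∀ i, t i = 1 ∨ t i = -1) (s : ℤ)
    (m : ℕ) : t (s + m) = t s * (-1) ^ signChanges t s m := by
  induction m with
  | zero => simp [signChanges]
  | succ m ih =>
    have h : signChanges t s (m + 1) =
        signChanges t s m + if t (s + m) ≠ t (s + m + 1) then 1 else 0 := by
      simp only [signChanges, Finset.sum_range_succ]
    rw [h, pow_add, ← mul_assoc, ← ih]
    push_cast
    rw [← add_assoc]
    by_cases e : t (s + m) = t (s + m + 1)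
    · simp [e]
    · rw [if_pos e, pow_one]
      rcases ht (s + m) with a | a <;> rcases ht (s + m + 1) with b | b <;> rw [a, b] at e ⊢ <;>
        first | exact absurd rfl e | norm_num

theorem eq_of_forall_succ_eq {t : ℤ → ℝ} {p q : ℤ}
    (h : ∀ i, p ≤ i → i < q → t i = t (i + 1)) (i : ℤ) (hp : p ≤ i) (hq : i ≤ q) : t i = t p := by
  induction i, hp using Int.leInduction with
  | base => rfl
  | succ i hi ih => rw [← h i hi (by omega), ih (by omega)]

/-- `t` is a sequence of signs of `D`, where a zero term of `D` gets the sign of the next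
nonzero term. -/
def IsSignOfNext (D t : ℤ → ℝ) : Prop :=
  ∀ i, ∃ k : ℕ, (∀ j : ℕ, j < k → D (i + j) = 0) ∧ D (i + k) ≠ 0 ∧
    (t i = 1 ∨ t i = -1) ∧ 0 < t i * D (i + k)

theorem exists_sign_of_next_nonzero {D : ℤ → ℝ} (hD : ∀ i, ∃ k : ℕ, D (i + k) ≠ 0) :
    ∃ t : ℤ → ℝ, IsSignOfNext D t := by
  classical
  refine ⟨fun i => if 0 < D (i + (Nat.find (hD i) : ℕ)) then 1 else -1, fun i => ?_⟩
  refine ⟨Nat.find (hD i), fun j hj => not_not.1 (Nat.find_min (hD i) hj),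
    Nat.find_spec (hD i), ?_, ?_⟩
  · dsimp only
    split_ifs <;> simp
  · dsimp only
    have := Nat.find_spec (hD i)
    split_ifs with h
    · simpa using h
    · have := lt_of_le_of_ne (not_lt.1 h) this
      linarith

namespace IsSignOfNext

variable {D t : ℤ → ℝ}

theorem eq_or (h : IsSignOfNext D t) (i : ℤ) : t i = 1 ∨ t i = -1 := by
  obtain ⟨k, -, -, h, -⟩ := h i
  exact h

theorem mul_nonneg (h : IsSignOfNext D t) (i : ℤ) : 0 ≤ t i * D i := by
  obtain ⟨k, h0, -, -, h⟩ := h i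
  rcases Nat.eq_zero_or_pos k with rfl | hk
  · simpa using h.le
  · have := h0 0 hk
    simp only [Nat.cast_zero, add_zero] at this
    simp [this]

/-- Two signs determined by nonzero terms that are proportional with factor `e = ±1` differ by
that factor. -/
theorem shift (h : IsSignOfNext D t) {m : ℤ} {e : ℝ} (he : e = 1 ∨ e = -1)
    (hm : ∀ i, D (i + m) = e * D i) (i : ℤ) : t (i + m) = e * t i := by
  obtain ⟨k, h0, h1, h2, h3⟩ := h i
  obtain ⟨l, g0, g1, g2, g3⟩ := h (i + m)
  have hs : ∀ j : ℕ, D (i + m + j) = e * D (i + j) := fun j => by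
    rw [← hm]; congr 1; ring
  have hkl : k = l := by
    rcases lt_trichotomy k l with hl | hl | hl
    · have := g0 k hl
      rw [hs] at this
      rcases he with rfl | rfl <;> simp [h1] at this
    · exact hl
    · rw [hs, h0 l hl] at g1
      simp at g1
  subst hkl
  rw [hs] at g3
  rcases he with rfl | rfl <;> rcases h2 with a | a <;> rcases g2 with b | b <;>
    rw [a] at h3 ⊢ <;> rw [b] at g3 ⊢ <;> norm_num at * <;> linarith

/-- If `D i` vanished, `i` and `i + 1` would look ahead to the same nonzero term. -/
theorem ne_zero_of_ne (h : IsSignOfNext D t) {i : ℤ} (hi : t i ≠ t (i + 1)) : D i ≠ 0 := by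
  intro h0
  apply hi
  obtain ⟨k, a0, a1, a2, a3⟩ := h i
  obtain ⟨l, g0, g1, g2, g3⟩ := h (i + 1)
  have hs : ∀ j : ℕ, D (i + 1 + j) = D (i + (j + 1 : ℕ)) := fun j => by
    congr 1; push_cast; ring
  have hkl : k = l + 1 := by
    rcases lt_trichotomy k (l + 1) with hl | hl | hl
    · rcases Nat.eq_zero_or_pos k with rfl | hk
      · simp [h0] at a1
      · have := g0 (k - 1) (by omega)
        rw [hs, Nat.sub_add_cancel hk] at this
        exact absurd this a1
    · exact hl
    · rw [hs, a0 _ hl] at g1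
      exact absurd rfl g1
  subst hkl
  rw [hs] at g3
  rcases a2 with a | a <;> rcases g2 with b | b <;>
    rw [a] at a3 ⊢ <;> rw [b] at g3 ⊢ <;> norm_num at * <;> linarith

theorem exists_zero_crossing (h : IsSignOfNext D t) {i : ℤ} (hi : t i ≠ t (i + 1)) :
    ∃ b, i + 1 ≤ b ∧ (∀ j, i + 1 ≤ j → j < b → D j = 0) ∧ D i * D b < 0 := by
  have hne := h.ne_zero_of_ne hi
  have hn := h.mul_nonneg i
  obtain ⟨l, g0, g1, g2, g3⟩ := h (i + 1)
  refine ⟨i + 1 + l, by omega, fun j hj hjb => ?_, ?_⟩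
  · have := g0 (j - (i + 1)).toNat (by omega)
    rwa [Int.toNat_of_nonneg (by omega), add_sub_cancel] at this
  · rcases h.eq_or i with a | a <;> rcases g2 with b | b <;> rw [a, b] at hi <;>
      rw [a] at hn <;> rw [b] at g3
    · exact absurd rfl hi
    · exact mul_neg_of_pos_of_neg (lt_of_le_of_ne (by linarith) hne.symm) (by linarith)
    · exact mul_neg_of_neg_of_pos (lt_of_le_of_ne (by linarith) hne) (by linarith)
    · exact absurd rfl hi

end IsSignOfNext

/-! ### Convex polygons -/

namespace PolygonalBall

variable {n : ℕ} (P : PolygonalBall n)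

theorem vertex_add_two_mul (i : ℤ) : P.vertex (i + 2 * n) = P.vertex i := by
  rw [two_mul, ← add_assoc, P.symm, P.symm, neg_neg]

theorem not_modEq_of_lt {i j N : ℤ} (h : i < j) (h' : j < i + N) : ¬ j ≡ i [ZMOD N] := by
  intro hm
  obtain ⟨k, hk⟩ := hm.symm.dvd
  have h1 : 0 < N * k := by linarith
  have h2 : N * k < N * 1 := by linarith
  have hN : 0 < N := by linarith
  have := lt_of_mul_lt_mul_left h2 hN.le
  have := pos_of_mul_pos_right h1 hN.le
  omega

theorem det2_side_pos {i k : ℤ} (h : i + 1 < k) (h' : k < i + 2 * n) :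
    0 < det2 (P.vertex (i + 1) - P.vertex i) (P.vertex k - P.vertex i) :=
  P.convex i k (not_modEq_of_lt (by omega) h') (not_modEq_of_lt h (by omega))

/-- Three vertices in counter-clockwise order span a positively oriented triangle. -/
theorem det2_triangle_pos {i j k : ℤ} (hij : i < j) (hjk : j < k) (hk : k < i + 2 * n) :
    0 < det2 (P.vertex j - P.vertex i) (P.vertex k - P.vertex i) := by
  rcases eq_or_lt_of_le (Int.add_one_le_iff.2 hij) with rfl | hij
  · exact P.det2_side_pos hjk hk
  -- Seen from side `m`, vertex `i` is vertex `i + 2 * n`, so side convexity applies to it.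
  have consec : ∀ m, i < m → m + 1 < i + 2 * n →
      0 < det2 (P.vertex m - P.vertex i) (P.vertex (m + 1) - P.vertex i) := fun m h1 h2 => by
    have := P.det2_side_pos (i := m) (k := i + 2 * n) h2 (by omega)
    rw [P.vertex_add_two_mul] at this
    simp only [det2, Prod.fst_sub, Prod.snd_sub] at this ⊢
    linarith
  have hjk' : j + 1 ≤ k := hjk
  clear hjk
  induction k, hjk' using Int.leInduction with
  | base => exact consec j (by omega) hk
  | succ k hjk ih =>
    have e1 := ih (by omega)
    have e2 := consec k (by omega) hk
    have e3 := P.det2_side_pos hij (by omega : j < i + 2 * n)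
    have e4 := P.det2_side_pos (by omega : i + 1 < k) (by omega : k < i + 2 * n)
    have e5 := P.det2_side_pos (by omega : i + 1 < k + 1) hk
    -- Plücker relation, used with `u` the side at `i` and `x, y, z` the vectors from vertex `i` to
    -- vertices `j, k, k + 1`; every other determinant in it is already positive.
    have key : ∀ u x y z : Plane, det2 u y * det2 x z = det2 u x * det2 y z +
        det2 u z * det2 x y := fun u x y z => by
      simp only [det2]; ring
    refine pos_of_mul_pos_right ?_ e4.le
    rw [key]
    positivity

theorem det2_vertex_side_pos (i : ℤ) : 0 < det2 (P.vertex i) (fwdDiffZ P.vertex i) := by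
  have := P.det2_vertex_pos i
  simp only [det2, fwdDiffZ, Prod.fst_sub, Prod.snd_sub] at this ⊢
  linarith

theorem det2_side_side_pos (i : ℤ) :
    0 < det2 (fwdDiffZ P.vertex i) (fwdDiffZ P.vertex (i + 1)) := by
  have := P.two_le
  have := P.det2_side_pos (i := i) (k := i + 1 + 1) (by omega) (by omega)
  simp only [det2, fwdDiffZ, Prod.fst_sub, Prod.snd_sub] at this ⊢
  linarith

theorem side_add (i : ℤ) : fwdDiffZ P.vertex (i + n) = - fwdDiffZ P.vertex i := by
  simp only [fwdDiffZ]
  rw [add_right_comm, P.symm, P.symm]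
  abel

theorem det2_dual (X : Plane) (i : ℤ) : det2 X (P.dual i) =
    det2 X (fwdDiffZ P.vertex i) / det2 (P.vertex i) (P.vertex (i + 1)) := by
  simp only [dual, det2, Prod.smul_fst, Prod.smul_snd, smul_eq_mul]
  ring

theorem dual_add (i : ℤ) : P.dual (i + n) = - P.dual i := by
  simp only [dual, P.side_add]
  rw [add_right_comm, P.symm, P.symm, smul_neg]
  simp [det2]

end PolygonalBall

/-! ### Radii of closed polygons -/

namespace PPolygon

variable {n : ℕ} {P : PolygonalBall n} {M : PPolygon P}

theorem eq_of_smul_side_eq {a b : ℝ} {i : ℤ}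
    (h : a • fwdDiffZ P.vertex i = b • fwdDiffZ P.vertex i) : a = b := by
  have := P.det2_vertex_side_pos i
  refine smul_left_injective ℝ (fun h0 => ?_) h
  rw [h0] at this
  simp [det2] at this

theorem radius_add_two_mul (hM : M.IsClosedPolygon) (i : ℤ) :
    M.radius (i + 2 * n) = M.radius i := by
  apply eq_of_smul_side_eq (P := P) (i := i)
  have h := M.side_eq (i + 2 * n)
  have hP : fwdDiffZ P.vertex (i + 2 * n) = fwdDiffZ P.vertex i := by
    simp only [fwdDiffZ]
    rw [add_right_comm, P.vertex_add_two_mul, P.vertex_add_two_mul]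
  rw [hP] at h
  rw [← h, ← M.side_eq]
  simp only [fwdDiffZ]
  rw [add_right_comm, hM, hM]

theorem isHomotheticToBall_of_radius (h : ∀ i, fwdDiffZ M.radius i = 0) :
    M.IsHomotheticToBall := by
  have hc : ∀ i, M.radius i = M.radius 0 := fun i => by
    induction i using Int.induction_on with
    | zero => rfl
    | succ i ih => rw [← ih]; exact sub_eq_zero.1 (h i)
    | pred i ih =>
      rw [← ih]
      have := h (-i - 1)
      rw [fwdDiffZ, sub_add_cancel] at this
      exact (sub_eq_zero.1 this).symm
  have hs : ∀ i, M.vertex (i + 1) - M.radius 0 • P.vertex (i + 1) =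
      M.vertex i - M.radius 0 • P.vertex i := fun i => by
    have := M.side_eq i
    rw [hc i, fwdDiffZ, fwdDiffZ, smul_sub] at this
    rw [sub_eq_sub_iff_sub_eq_sub]
    exact this
  refine ⟨M.vertex 0 - M.radius 0 • P.vertex 0, M.radius 0, fun i => ?_⟩
  rw [← sub_eq_iff_eq_add]
  induction i using Int.induction_on with
  | zero => rfl
  | succ i ih => rw [hs, ih]
  | pred i ih =>
    have := hs (-i - 1)
    rw [sub_add_cancel] at this
    rw [← this, ih]

/-- The radius differences of a closed polygon are orthogonal to the restrictions to the vertices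
of `P` of all affine functions. -/
theorem sum_radius_diff_mul (hM : M.IsClosedPolygon) (c : ℝ) (w : Plane) (s : ℤ) :
    ∑ k ∈ Finset.range (2 * n),
      fwdDiffZ M.radius (s + k) * (c + det2 w (P.vertex (s + k + 1))) = 0 := by
  -- A discrete primitive of the summand, because `r • ΔP = ΔM`; it is periodic since M is closed.
  set H : ℕ → ℝ := fun k => M.radius (s + k) * (c + det2 w (P.vertex (s + k))) -
    det2 w (M.vertex (s + k)) with hH
  have h : ∀ k ∈ Finset.range (2 * n),
      fwdDiffZ M.radius (s + k) * (c + det2 w (P.vertex (s + k + 1))) = H (k + 1) - H k := by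
    intro k _
    have e := M.side_eq (s + k)
    have e1 := congrArg Prod.fst e
    have e2 := congrArg Prod.snd e
    simp only [fwdDiffZ, Prod.fst_sub, Prod.snd_sub, Prod.smul_fst, Prod.smul_snd,
      smul_eq_mul] at e1 e2
    simp only [hH, Nat.cast_succ, ← add_assoc, fwdDiffZ, det2]
    linear_combination w.1 * e2 - w.2 * e1
  rw [Finset.sum_congr rfl h, Finset.sum_range_sub]
  simp only [hH]
  push_cast
  rw [radius_add_two_mul hM, P.vertex_add_two_mul, hM]
  simp

/-- For a polygon of constant width, radii of opposite sides have constant sum. -/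
theorem HasConstantWidth.exists_radius_add (hw : M.HasConstantWidth) :
    ∃ c, ∀ i, M.radius i + M.radius (i + n) = c := by
  obtain ⟨c, hc⟩ := hw
  refine ⟨c, ?_⟩
  -- The aim is `U = c • P`. Constant width makes `U i - c • P i` parallel to side `i`; as `U` has
  -- sides parallel to those of P, the next difference is parallel to side `i` too. Consecutive
  -- sides are independent, so the difference vanishes.
  set U : ℤ → Plane := fun i => M.vertex i - M.vertex (i + n) with hU
  have hside : ∀ i, U (i + 1) - U i = (M.radius i + M.radius (i + n)) • fwdDiffZ P.vertex i := by
    intro i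
    have h1 := M.side_eq i
    have h2 := M.side_eq (i + n)
    rw [P.side_add, smul_neg] at h2
    rw [add_smul, ← h1, ← neg_eq_iff_eq_neg.2 h2]
    simp only [hU, fwdDiffZ]
    rw [add_right_comm i 1]
    abel
  have hwid : ∀ i, det2 (U i - c • P.vertex i) (fwdDiffZ P.vertex i) = 0 := by
    intro i
    have h := hc i
    have hp := P.det2_vertex_pos i
    have e : det2 (U i) (P.dual i) = c := by
      rw [← h]
      simp only [width, support, P.dual_add, hU, det2, Prod.fst_sub, Prod.snd_sub, Prod.fst_neg,
        Prod.snd_neg]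
      ring
    rw [P.det2_dual, div_eq_iff hp.ne'] at e
    simp only [det2, fwdDiffZ, Prod.fst_sub, Prod.snd_sub, Prod.smul_fst, Prod.smul_snd,
      smul_eq_mul] at e ⊢
    linear_combination e
  have hnext : ∀ i, det2 (U (i + 1) - c • P.vertex (i + 1)) (fwdDiffZ P.vertex i) = 0 := by
    intro i
    have h := hwid i
    have e := hside i
    have e1 := congrArg Prod.fst e
    have e2 := congrArg Prod.snd e
    simp only [det2, fwdDiffZ, Prod.fst_sub, Prod.snd_sub, Prod.smul_fst, Prod.smul_snd,
      smul_eq_mul] at h e1 e2 ⊢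
    linear_combination h + ((P.vertex (i + 1)).2 - (P.vertex i).2) * e1 -
      ((P.vertex (i + 1)).1 - (P.vertex i).1) * e2
  have hzero : ∀ i, U i = c • P.vertex i := by
    intro i
    obtain ⟨i, rfl⟩ : ∃ j, i = j + 1 := ⟨i - 1, by ring⟩
    have h1 := hwid (i + 1)
    have h2 := hnext i
    have h3 := (P.det2_side_side_pos i).ne'
    rw [← sub_eq_zero]
    generalize U (i + 1) - c • P.vertex (i + 1) = X at *
    generalize fwdDiffZ P.vertex (i + 1) = v at *
    generalize fwdDiffZ P.vertex i = u at *
    simp only [det2] at h1 h2 h3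
    apply Prod.ext
    · apply mul_left_cancel₀ h3
      simp only [Prod.fst_zero]
      linear_combination u.1 * h1 - v.1 * h2
    · apply mul_left_cancel₀ h3
      simp only [Prod.snd_zero]
      linear_combination u.2 * h1 - v.2 * h2
  intro i
  apply eq_of_smul_side_eq (P := P) (i := i)
  rw [← hside, hzero, hzero, ← smul_sub]
  rfl

theorem HasConstantWidth.radius_diff_add (hw : M.HasConstantWidth) (i : ℤ) : fwdDiffZ M.radius (i + n) = - fwdDiffZ M.radius i := by
  obtain ⟨c, hc⟩ := hw.exists_radius_add
  have h1 := hc i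
  have h2 := hc (i + 1)
  simp only [fwdDiffZ]
  rw [add_right_comm i n 1]
  linarith

theorem radius_diff_add_two_mul (hM : M.IsClosedPolygon) (i : ℤ) :
    fwdDiffZ M.radius (i + 2 * n) = fwdDiffZ M.radius i := by
  simp only [fwdDiffZ]
  rw [add_right_comm, radius_add_two_mul hM, radius_add_two_mul hM]

theorem radius_diff_add_mul (hM : M.IsClosedPolygon) (i : ℤ) (k : ℕ) :
    fwdDiffZ M.radius (i + 2 * n * k) = fwdDiffZ M.radius i := by
  induction k with
  | zero => simp
  | succ k ih =>
    rw [← ih, ← radius_diff_add_two_mul hM (i + 2 * n * k)]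
    congr 1
    push_cast
    ring

theorem exists_isSignOfNext (hM : M.IsClosedPolygon) (hball : ¬ M.IsHomotheticToBall) :
    ∃ t, IsSignOfNext (fwdDiffZ M.radius) t := by
  refine exists_sign_of_next_nonzero fun i => ?_
  by_contra! h
  refine hball (isHomotheticToBall_of_radius fun j => ?_)
  have hn := P.two_le
  -- Moving `j` forward by `i - j` whole periods takes it past `i`.
  have hle : i ≤ j + 2 * n * ((i - j).toNat : ℕ) := by
    have h1 : i - j ≤ ((i - j).toNat : ℤ) := Int.self_le_toNat _
    have h2 : (0 : ℤ) ≤ ((i - j).toNat : ℤ) := by positivity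
    have h3 : (1 : ℤ) * ((i - j).toNat : ℤ) ≤ 2 * n * ((i - j).toNat : ℤ) :=
      mul_le_mul_of_nonneg_right (by omega) h2
    linarith
  have := h (j + 2 * n * ((i - j).toNat : ℕ) - i).toNat
  rw [Int.toNat_of_nonneg (by linarith), add_sub_cancel, radius_diff_add_mul hM] at this
  exact this

/-! ### Lower bounds for sign changes and edgices -/

variable {t : ℤ → ℝ}

theorem signChanges_ne_zero (hM : M.IsClosedPolygon)
    (ht : IsSignOfNext (fwdDiffZ M.radius) t) : signChanges t 0 (2 * n) ≠ 0 := by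
  intro h
  simp only [signChanges, Finset.sum_eq_zero_iff, Finset.mem_range, ite_eq_right_iff,
    one_ne_zero, imp_false, not_not, zero_add] at h
  have hc : ∀ k : ℕ, k < 2 * n → t k = t 0 := fun k hk =>
    eq_of_forall_succ_eq (q := k) (fun i h0 hi => by
      have := h i.toNat (by omega)
      rwa [Int.toNat_of_nonneg h0] at this) k (by omega) le_rfl
  -- Testing against the constant `t 0` makes every term nonnegative.
  have hsum := sum_radius_diff_mul hM (t 0) 0 0
  simp only [det2, Prod.fst_zero, Prod.snd_zero, zero_mul, sub_zero, add_zero, zero_add] at hsum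
  have hterm := (Finset.sum_eq_zero_iff_of_nonneg (fun k hk => by
    have := ht.mul_nonneg k
    rw [hc k (Finset.mem_range.1 hk)] at this
    linarith)).1 hsum
  obtain ⟨k, -, hk, -⟩ := ht 0
  have hn := P.two_le
  have hlt : k % (2 * n) < 2 * n := Nat.mod_lt _ (by omega)
  have h1 := hterm (k % (2 * n)) (Finset.mem_range.2 hlt)
  have h2 := radius_diff_add_mul hM ((k % (2 * n) : ℕ) : ℤ) (k / (2 * n))
  have h3 : ((k % (2 * n) : ℕ) : ℤ) + 2 * n * ((k / (2 * n) : ℕ) : ℤ) = 0 + k := by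
    rw [zero_add]
    exact_mod_cast Nat.mod_add_div k (2 * n)
  rw [h3] at h2
  rw [h2] at hk
  rcases mul_eq_zero.1 h1 with h4 | h4
  · exact hk h4
  · rcases ht.eq_or 0 with h5 | h5 <;> rw [h5] at h4 <;> norm_num at h4

/-- The signs of the radius differences do not split a period into two constant blocks: otherwise
an affine function vanishing on a diagonal of `P` separates the blocks. -/
theorem not_two_constant_blocks (hM : M.IsClosedPolygon)
    (ht : IsSignOfNext (fwdDiffZ M.radius) t) {a b : ℤ} (hab : a < b) (hba : b < a + 2 * n)
    (ha : fwdDiffZ M.radius (a - 1) ≠ 0) (hb : fwdDiffZ M.radius (b - 1) ≠ 0) {e : ℝ}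
    (h1 : ∀ i, a ≤ i → i < b → t i = -e) (h2 : ∀ i, b ≤ i → i < a + 2 * n → t i = e) : False := by
  have hn := P.two_le
  have he : e = 1 ∨ e = -1 := by
    rw [← h2 b le_rfl hba]
    exact ht.eq_or b
  set p := P.vertex (a + 1) with hp
  set q := P.vertex (b + 1) with hq
  -- The side of the diagonal through vertices `a + 1` and `b + 1`; the shift by one matches the
  -- pairing of `Δr` at `i` with vertex `i + 1`.
  set f : ℤ → ℝ := fun i => det2 (q - p) (P.vertex i - p) with hf
  have hf1 : ∀ i, a + 1 < i → i < b + 1 → f i < 0 := fun i hi hi' => by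
    have := P.det2_triangle_pos hi hi' (by omega)
    simp only [hf, hp, hq, det2, Prod.fst_sub, Prod.snd_sub] at this ⊢
    linarith
  have hf2 : ∀ i, b + 1 < i → i < a + 1 + 2 * n → 0 < f i := fun i hi hi' =>
    P.det2_triangle_pos (by omega) hi hi'
  have hfa : f (a + 1) = 0 := by simp [hf, hp, det2]
  have hfb : f (b + 1) = 0 := by simp only [hf, ← hq, det2]; ring
  have hsum := sum_radius_diff_mul hM (e * - det2 (q - p) p) (e • (q - p)) a
  have heq : ∀ k : ℕ, e * - det2 (q - p) p + det2 (e • (q - p)) (P.vertex (a + k + 1)) =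
      e * f (a + k + 1) := fun k => by
    simp only [hf, det2, Prod.fst_sub, Prod.snd_sub, Prod.smul_fst, Prod.smul_snd, smul_eq_mul]
    ring
  simp only [heq] at hsum
  have hterm := (Finset.sum_eq_zero_iff_of_nonneg (fun k hk => by
    have hk' := Finset.mem_range.1 hk
    have hs := ht.mul_nonneg (a + k)
    rcases lt_or_ge (a + (k : ℤ)) b with hlt | hge
    · rw [h1 _ (by omega) hlt] at hs
      rcases Nat.eq_zero_or_pos k with rfl | hk0
      · simp [hfa]
      · have := mul_nonneg hs (neg_nonneg.2 (hf1 (a + k + 1) (by omega) (by omega)).le)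
        linarith
    · rw [h2 _ hge (by omega)] at hs
      rcases eq_or_lt_of_le hge with heq | hgt
      · rw [← heq, hfb]; simp
      · have := mul_nonneg hs (hf2 (a + k + 1) (by omega) (by omega)).le
        linarith)).1 hsum
  have hfz : ∀ i, a ≤ i → i < a + 2 * n → fwdDiffZ M.radius i ≠ 0 → f (i + 1) = 0 := by
    intro i hi hi' hne
    have := hterm (i - a).toNat (Finset.mem_range.2 (by omega))
    rw [Int.toNat_of_nonneg (by omega), add_sub_cancel] at this
    rcases mul_eq_zero.1 this with h | h
    · exact absurd h hne
    · rcases mul_eq_zero.1 h with h | h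
      · rcases he with rfl | rfl <;> norm_num at h
      · exact h
  -- Only `a` and `b` can now carry a nonzero difference in the window. But `a - 1`, moved by a
  -- period, carries one and differs from `b` unless `b = a + 2n - 1`; in that case `b - 1` differs
  -- from `a` because `2 ≤ n`.
  rcases lt_or_ge (b + 1) (a + 2 * n) with hlt | hge
  · have h3 := hfz (a - 1 + 2 * n) (by omega) (by omega)
      (by rwa [radius_diff_add_two_mul hM])
    exact (hf2 (a - 1 + 2 * n + 1) (by omega) (by omega)).ne' h3
  · have h3 := hfz (b - 1) (by omega) (by omega) hb
    exact (hf1 (b - 1 + 1) (by omega) (by omega)).ne h3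

theorem signChanges_ne_two (hM : M.IsClosedPolygon)
    (ht : IsSignOfNext (fwdDiffZ M.radius) t) : signChanges t 0 (2 * n) ≠ 2 := by
  intro h
  rw [signChanges_eq_card, Finset.card_eq_two] at h
  obtain ⟨x, y, hxy, h⟩ := h
  wlog hlt : x < y generalizing x y
  · exact this y x hxy.symm (by rw [h, Finset.pair_comm]) (by omega)
  have hmem : ∀ k : ℕ, (k < 2 * n ∧ t k ≠ t (k + 1)) ↔ k = x ∨ k = y := fun k => by
    have := Finset.ext_iff.1 h k
    simpa only [Finset.mem_filter, Finset.mem_range, zero_add, Finset.mem_insert,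
      Finset.mem_singleton] using this
  obtain ⟨hx, hx'⟩ := (hmem x).2 (Or.inl rfl)
  obtain ⟨hy, hy'⟩ := (hmem y).2 (Or.inr rfl)
  have hstep : ∀ i : ℤ, 0 ≤ i → i < 2 * n → i ≠ x → i ≠ y → t i = t (i + 1) := by
    intro i h0 hN h1 h2
    by_contra hne
    have := (hmem i.toNat).1 ⟨by omega, by rwa [Int.toNat_of_nonneg h0]⟩
    omega
  have hper : ∀ i, t (i + 2 * n) = t i := fun i => by
    simpa using ht.shift (e := 1) (Or.inl rfl)
      (fun i => by rw [radius_diff_add_two_mul hM, one_mul]) i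
  have hblock1 : ∀ i : ℤ, (x : ℤ) + 1 ≤ i → i ≤ y → t i = t (x + 1) :=
    eq_of_forall_succ_eq fun i h1 h2 => hstep i (by omega) (by omega) (by omega) (by omega)
  -- This block wraps around the end of the period.
  have hblock2 : ∀ i : ℤ, (y : ℤ) + 1 ≤ i → i ≤ x + 2 * n → t i = t (y + 1) :=
    eq_of_forall_succ_eq fun i h1 h2 => by
      rcases lt_or_ge i (2 * n) with hi | hi
      · exact hstep i (by omega) hi (by omega) (by omega)
      · have := hstep (i - 2 * n) (by omega) (by omega) (by omega) (by omega)
        rw [← hper (i - 2 * n), ← hper (i - 2 * n + 1), sub_add_cancel] at this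
        rwa [show i - 2 * n + 1 + 2 * (n : ℤ) = i + 1 by ring] at this
  have hneg : t (x + 1) = - t (y + 1) := by
    rw [hblock1 y (by omega) le_rfl] at hy'
    rcases ht.eq_or (x + 1) with h1 | h1 <;> rcases ht.eq_or (y + 1) with h2 | h2 <;>
      rw [h1, h2] at hy' ⊢ <;>
      first | exact absurd rfl hy' | norm_num
  refine not_two_constant_blocks hM ht (a := x + 1) (b := y + 1) (e := t (y + 1)) (by omega)
    (by omega) ?_ ?_ (fun i h1 h2 => ?_) (fun i h1 h2 => hblock2 i h1 (by omega))
  · rw [add_sub_cancel_right]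
    exact ht.ne_zero_of_ne hx'
  · rw [add_sub_cancel_right]
    exact ht.ne_zero_of_ne hy'
  · rw [hblock1 i h1 (by omega), hneg]

theorem four_le_signChanges (hM : M.IsClosedPolygon)
    (ht : IsSignOfNext (fwdDiffZ M.radius) t) : 4 ≤ signChanges t 0 (2 * n) := by
  have h0 := signChanges_ne_zero hM ht
  have h2 := signChanges_ne_two hM ht
  have hpar : Even (signChanges t 0 (2 * n)) := by
    have hpow := eq_mul_neg_one_pow_signChanges ht.eq_or 0 (2 * n)
    have hper := ht.shift (e := 1) (m := 2 * n) (Or.inl rfl)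
      (fun i => by rw [radius_diff_add_two_mul hM, one_mul]) 0
    push_cast at hpow
    rw [hper] at hpow
    by_contra hodd
    rw [(Nat.not_even_iff_odd.1 hodd).neg_one_pow] at hpow
    rcases ht.eq_or 0 with h | h <;> rw [h] at hpow <;> norm_num at hpow
  obtain ⟨k, hk⟩ := hpar
  omega

theorem six_le_signChanges (hM : M.IsClosedPolygon) (hw : M.HasConstantWidth)
    (ht : IsSignOfNext (fwdDiffZ M.radius) t) : 6 ≤ signChanges t 0 (2 * n) := by
  have h4 := four_le_signChanges hM ht
  have hper := ht.shift (e := -1) (m := n) (Or.inr rfl)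
    (fun i => by rw [hw.radius_diff_add, neg_one_mul])
  have hhalf : signChanges t (0 + n) n = signChanges t 0 n := by
    refine Finset.sum_congr rfl fun k _ => ?_
    rw [add_right_comm 0 (n : ℤ) k, add_right_comm _ (n : ℤ) 1, hper, hper]
    simp
  have hpar : Odd (signChanges t 0 n) := by
    have hpow := eq_mul_neg_one_pow_signChanges ht.eq_or 0 n
    rw [hper] at hpow
    by_contra hodd
    rw [(Nat.not_odd_iff_even.1 hodd).neg_one_pow] at hpow
    rcases ht.eq_or 0 with h | h <;> rw [h] at hpow <;> norm_num at hpow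
  rw [two_mul, signChanges_add, hhalf] at h4 ⊢
  obtain ⟨k, hk⟩ := hpar
  omega

/-- A sign change at `k` is sent to the edgex with first side `k + 1`, since the difference at `k`
compares sides `k` and `k + 1`. -/
theorem signChanges_le_edgexCount (ht : IsSignOfNext (fwdDiffZ M.radius) t) :
    signChanges t 0 (2 * n) ≤ M.edgexCount := by
  have hinj : Function.Injective fun k : ℕ => (k : ℤ) + 1 := fun x y h => by
    simpa using h
  rw [signChanges_eq_card, ← Finset.card_image_of_injective _ hinj,
    ← Set.ncard_coe_finset, edgexCount]
  refine Set.ncard_le_ncard ?_ ((Set.finite_Icc (1 : ℤ) (2 * n)).subset fun a ha => ⟨ha.1, ha.2.1⟩)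
  intro a ha
  simp only [Finset.coe_image, Finset.coe_filter, Set.mem_image, Set.mem_ofPred_eq,
    Finset.mem_range, zero_add] at ha
  obtain ⟨k, ⟨hk, hne⟩, rfl⟩ := ha
  obtain ⟨b, hb, hz, hneg⟩ := ht.exists_zero_crossing hne
  refine ⟨by omega, by omega, b, (M.isEdgex_iff _ b).2 ⟨hb, hz, ?_⟩⟩
  rwa [add_sub_cancel_right]

end PPolygon

/-- The four edgex theorem. -/
theorem mainTheorem3 {n : ℕ} (P : PolygonalBall n) (M : PPolygon P)
    (hclosed : M.IsClosedPolygon) (hconvex : M.IsConvexPolygon)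
    (hball : ¬ M.IsHomotheticToBall) :
    4 ≤ M.edgexCount ∧ (M.HasConstantWidth → 6 ≤ M.edgexCount) := by
  obtain ⟨t, ht⟩ := PPolygon.exists_isSignOfNext hclosed hball
  have hle := PPolygon.signChanges_le_edgexCount ht
  exact ⟨(PPolygon.four_le_signChanges hclosed ht).trans hle,
    fun hw => (PPolygon.six_le_signChanges hclosed hw ht).trans hle⟩
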